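/- Theorem. There exist a convex $C^1$ function $f\colon\mathbb{R}^2\to\mathbb{R}$ whose unique minimizer is the origin, a point $X_0\neq 0$ in $\mathbb{R}^2$, and a global solution $X\colon[0,\infty)\to\mathbb{R}^2$ (that is, $X$ is $C^1$ on $[0,\infty)$ and $C^2$ on $(0,\infty)$) of the critical Nesterov ODE \[ \ddot X(t)+\frac{3}{t}\dot X(t)+\nabla f(X(t))=0\quad(t>0),\qquad X(0)=X_0,\qquad \dot X(0)=0, \] such that \[ \int_0^\infty\|\dot X(t)\|\,\mathrm{d}t=\infty . \] Moreover, $f$ can be taken of the form \[ f(x_1,x_2)=F\Bigl(\sqrt{x_1^2+x_2^2}\Bigr)+\varepsilon\,\Psi_a(x_1) \] for some $a>0$ and $\varepsilon>0$, where $\Psi_a(u)=\tfrac12\max\{u-a,0\}^2$ and $F\colon[0,\infty)\to\mathbb{R}$ is given by $F(0)=0$, $F(r)=\int_0^r\frac{\mathrm{d}u}{-\log u}$ for $0<r\le e^{-2}$, and $F(r)=F(e^{-2})+\tfrac12(r-e^{-2})$ for $r\ge e^{-2}$. -/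

import Mathlib

open Set MeasureTheory

/-- The radial profile `F` on `[0, ∞)`: `F r = ∫₀ʳ du / (-log u)` for `0 ≤ r ≤ e⁻²`, continued
affinely with slope `1/2` for `r ≥ e⁻²`. It is only ever evaluated at `r = ‖x‖ ≥ 0`. -/
noncomputable def radialProfile (r : ℝ) : ℝ :=
  if r ≤ Real.exp (-2) then ∫ u in (0 : ℝ)..r, 1 / (-Real.log u)
  else (∫ u in (0 : ℝ)..Real.exp (-2), 1 / (-Real.log u)) + (1 / 2) * (r - Real.exp (-2))

/-- The one-sided quadratic `Ψ_a(u) = (u - a)₊² / 2`. -/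
noncomputable def oneSidedQuadratic (a u : ℝ) : ℝ := (1 / 2) * (max (u - a) 0) ^ 2

/-- The potential `f_{ε,a}(x) = F(‖x‖) + ε Ψ_a(x₁)` on the Euclidean plane. -/
noncomputable def almostRadialPotential (ε a : ℝ) (x : EuclideanSpace ℝ (Fin 2)) : ℝ :=
  radialProfile ‖x‖ + ε * oneSidedQuadratic a (x 0)

/-- `X : [0, ∞) → E` is a global (classical) solution of the critical Nesterov ODE
`X'' + (3/t) X' + ∇f(X) = 0` for `t > 0`, with `X(0) = X₀` and `X'(0) = 0`: it is `C¹` on `[0, ∞)`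
and `C²` on `(0, ∞)`, and satisfies the equation and the initial conditions. The values of `X` at
negative times play no role. -/
structure IsGlobalNesterovSolution {E : Type*} [NormedAddCommGroup E] [InnerProductSpace ℝ E]
    [CompleteSpace E] (f : E → ℝ) (X₀ : E) (X : ℝ → E) : Prop where
  contDiffOn_one : ContDiffOn ℝ 1 X (Ici 0)
  contDiffOn_two : ContDiffOn ℝ 2 X (Ioi 0)
  ode : ∀ t : ℝ, 0 < t → deriv (deriv X) t + (3 / t) • deriv X t + gradient f (X t) = 0
  initial_position : X 0 = X₀
  initial_velocity : HasDerivWithinAt X 0 (Ici 0) 0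

/-- The path length `∫₀^∞ ‖X'(t)‖ dt`, as an element of `[0, ∞]`. -/
noncomputable def pathLength {E : Type*} [NormedAddCommGroup E] [NormedSpace ℝ E]
    (X : ℝ → E) : ENNReal :=
  ∫⁻ t in Ioi (0 : ℝ), ‖deriv X t‖ₑ

/-! Take `ε = 1`, `a = 24/25`, and launch from rest at `(1, 1/5)`. A radial force exerts no torque,
so `t³` times the angular momentum changes only through the term `Ψ_a(x₁)`, whose torque has the
sign of `x₂` and acts only where `x₁ > a`. Initially `x₂ > 0`, so a positive momentum is created.
Energy loss prevents a return to `x₁ > a` once `x₁` has fallen to `1/2`, and `x₂` is still positive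
during any visit before that. Hence the scaled momentum never decreases, and `t³ ‖X‖ ‖V‖ ≥ c > 0`
for `t ≥ 1/5` (`le_norm_mul_norm`).

This is used twice. With the energy bound `‖V‖ < 2` it gives `‖X‖ ≥ c / (2 t³)`: the orbit avoids
the origin, where the gradient is not Lipschitz, and `log (1/‖X‖)` is at most of order `log t`. The
standard Lyapunov function gives `t² f(X) ≤ 3`; since `F(r)` is at least of order `r / log (1/r)`
for small `r`, it follows that `t² ‖X‖ ≤ C log t` for large `t` (`norm_position_le_log`). Dividing,
`‖V‖ ≥ c' / (t log t)`, which is not integrable at infinity.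

Existence comes from a field frozen inside a shrinking ball around the origin; the lower bound on
`‖X‖` shows that the solution never enters that ball. -/

section Profile

/-! ### The radial profile and its slope. -/

open Filter Topology

/-- The derivative of the radial profile, extended evenly to `ℝ`. -/
noncomputable def radialSlope (r : ℝ) : ℝ := (-Real.log (min |r| (Real.exp (-2))))⁻¹

/-- The conventions `log 0 = 0` and `0⁻¹ = 0` produce exactly the limit at the origin, so continuity
holds there too. -/
theorem radialSlope_zero : radialSlope 0 = 0 := by
  simp [radialSlope, (Real.exp_pos _).le]

theorem radialSlope_of_le {r : ℝ} (h0 : 0 ≤ r) (h : r ≤ Real.exp (-2)) :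
    radialSlope r = 1 / (-Real.log r) := by
  rw [radialSlope, abs_of_nonneg h0, min_eq_left h, one_div]

theorem radialSlope_of_ge {r : ℝ} (h : Real.exp (-2) ≤ r) : radialSlope r = 1 / 2 := by
  rw [radialSlope, abs_of_nonneg ((Real.exp_pos _).le.trans h), min_eq_right h, Real.log_exp]
  norm_num

theorem two_le_neg_log_min {r : ℝ} (h : 0 < r) : 2 ≤ -Real.log (min |r| (Real.exp (-2))) := by
  have h1 : Real.log (min |r| (Real.exp (-2))) ≤ Real.log (Real.exp (-2)) :=
    Real.log_le_log (lt_min (abs_pos.2 h.ne') (Real.exp_pos _)) (min_le_right _ _)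
  rw [Real.log_exp] at h1
  linarith

theorem radialSlope_pos {r : ℝ} (h : 0 < r) : 0 < radialSlope r :=
  inv_pos.2 (by linarith [two_le_neg_log_min h])

theorem radialSlope_nonneg {r : ℝ} (h : 0 ≤ r) : 0 ≤ radialSlope r := by
  rcases h.eq_or_lt with rfl | h
  · rw [radialSlope_zero]
  · exact (radialSlope_pos h).le

theorem monotoneOn_radialSlope : MonotoneOn radialSlope (Ici 0) := by
  intro r hr s hs h
  rcases (mem_Ici.1 hr).eq_or_lt with rfl | hr
  · rw [radialSlope_zero]
    exact radialSlope_nonneg hs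
  · have hs' : 0 < s := hr.trans_le h
    refine inv_anti₀ (by linarith [two_le_neg_log_min hs']) (neg_le_neg ?_)
    refine Real.log_le_log (lt_min (abs_pos.2 hr.ne') (Real.exp_pos _)) ?_
    rw [abs_of_pos hr, abs_of_pos hs']
    exact min_le_min_right _ h

theorem radialSlope_le_half {r : ℝ} (h : 0 ≤ r) : radialSlope r ≤ 1 / 2 := by
  rcases h.eq_or_lt with rfl | h
  · rw [radialSlope_zero]
    norm_num
  · rw [one_div]
    exact inv_anti₀ two_pos (two_le_neg_log_min h)

/-- The reciprocal is `r * L(r)` with `L ≥ 2`. Between `n ≤ m`, `L` drops by at most `log (m/n) ≤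
m/n - 1`, so the loss `n (L(n) - L(m)) ≤ m - n` is outweighed by the gain `(m - n) L(m)`. -/
theorem antitoneOn_radialSlope_div : AntitoneOn (fun r => radialSlope r / r) (Ioi 0) := by
  intro n hn m hm h
  simp only [mem_Ioi] at hn hm
  have hlm := two_le_neg_log_min hm
  have hln := two_le_neg_log_min hn
  have hc := Real.exp_pos (-2)
  simp only [radialSlope, abs_of_pos hn, abs_of_pos hm] at *
  set c := Real.exp (-2)
  have h1 : Real.log (min m c) ≤ Real.log (m / n * min n c) := by
    refine Real.log_le_log (lt_min hm hc) ?_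
    have h2 : 1 ≤ m / n := (one_le_div hn).2 h
    rcases min_cases n c with h' | h' <;> rw [h'.1]
    · rw [div_mul_cancel₀ _ hn.ne']
      exact min_le_left _ _
    · exact (min_le_right _ _).trans (le_mul_of_one_le_left hc.le h2)
  rw [Real.log_mul (div_pos hm hn).ne' (lt_min hn hc).ne'] at h1
  have h2 := Real.log_le_sub_one_of_pos (div_pos hm hn)
  have h3 : n * (Real.log (min m c) - Real.log (min n c)) ≤ m - n := by
    have : n * (m / n - 1) = m - n := by field_simp
    rw [← this]
    exact mul_le_mul_of_nonneg_left (by linarith) hn.le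
  rw [inv_eq_one_div, inv_eq_one_div, div_div, div_div]
  refine one_div_le_one_div_of_le (by nlinarith) ?_
  nlinarith

theorem continuous_radialSlope : Continuous radialSlope := by
  rw [continuous_iff_continuousAt]
  intro r
  rcases eq_or_ne r 0 with rfl | hr
  · rw [continuousAt_iff_punctured_nhds, radialSlope_zero]
    refine Tendsto.inv_tendsto_atTop (tendsto_neg_atBot_atTop.comp
      (Real.tendsto_log_nhdsGT_zero.comp ?_))
    refine tendsto_nhdsWithin_iff.2 ⟨?_, ?_⟩
    · have : Continuous fun x : ℝ => min |x| (Real.exp (-2)) := by fun_prop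
      have h := this.tendsto 0
      simp only [abs_zero, min_eq_left (Real.exp_pos (-2)).le] at h
      exact h.mono_left nhdsWithin_le_nhds
    · filter_upwards [self_mem_nhdsWithin] with x hx
      exact lt_min (abs_pos.2 hx) (Real.exp_pos _)
  · have hpos : 0 < |r| := abs_pos.2 hr
    have h1 : min |r| (Real.exp (-2)) ≠ 0 := (lt_min hpos (Real.exp_pos _)).ne'
    have h2 := two_le_neg_log_min hpos
    rw [abs_abs] at h2
    have h3 : ContinuousAt (fun x : ℝ => -Real.log (min |x| (Real.exp (-2)))) r := by
      have h4 : Continuous fun x : ℝ => min |x| (Real.exp (-2)) := by fun_prop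
      exact (h4.continuousAt.log h1).neg
    exact h3.inv₀ (by linarith)

/-- The primitive of `radialSlope`; it agrees with `radialProfile` on `[0, ∞)`. -/
noncomputable def radialPrimitive (r : ℝ) : ℝ := ∫ u in (0 : ℝ)..r, radialSlope u

theorem radialPrimitive_zero : radialPrimitive 0 = 0 := by simp [radialPrimitive]

theorem hasDerivAt_radialPrimitive (r : ℝ) : HasDerivAt radialPrimitive (radialSlope r) r :=
  intervalIntegral.integral_hasDerivAt_right (continuous_radialSlope.intervalIntegrable _ _)
    continuous_radialSlope.stronglyMeasurable.stronglyMeasurableAtFilter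
    continuous_radialSlope.continuousAt

theorem radialPrimitive_sub (r s : ℝ) :
    radialPrimitive s - radialPrimitive r = ∫ u in r..s, radialSlope u :=
  intervalIntegral.integral_interval_sub_left (continuous_radialSlope.intervalIntegrable _ _)
    (continuous_radialSlope.intervalIntegrable _ _)

theorem radialPrimitive_sub_of_ge {r s : ℝ} (hr : Real.exp (-2) ≤ r) (hs : r ≤ s) :
    radialPrimitive s - radialPrimitive r = 1 / 2 * (s - r) := by
  rw [radialPrimitive_sub, intervalIntegral.integral_congr (g := fun _ => (1 / 2 : ℝ))]
  · simp
    ring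
  · intro u hu
    rw [uIcc_of_le hs] at hu
    exact radialSlope_of_ge (hr.trans hu.1)

theorem radialProfile_eq {r : ℝ} (h0 : 0 ≤ r) : radialProfile r = radialPrimitive r := by
  have key : ∀ s, 0 ≤ s → s ≤ Real.exp (-2) →
      ∫ u in (0 : ℝ)..s, 1 / (-Real.log u) = radialPrimitive s := by
    intro s hs0 hs
    refine intervalIntegral.integral_congr fun u hu => ?_
    rw [uIcc_of_le hs0] at hu
    exact (radialSlope_of_le hu.1 (hu.2.trans hs)).symm
  unfold radialProfile
  split_ifs with h
  · exact key r h0 h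
  · rw [key _ (Real.exp_pos _).le le_rfl]
    linarith [radialPrimitive_sub_of_ge le_rfl (not_le.1 h).le]

theorem monotoneOn_radialPrimitive : MonotoneOn radialPrimitive (Ici 0) := by
  refine monotoneOn_of_deriv_nonneg (convex_Ici 0)
    (fun r _ => (hasDerivAt_radialPrimitive r).continuousAt.continuousWithinAt)
    (fun r _ => (hasDerivAt_radialPrimitive r).differentiableAt.differentiableWithinAt) ?_
  intro r hr
  rw [interior_Ici] at hr
  rw [(hasDerivAt_radialPrimitive r).deriv]
  exact radialSlope_nonneg (le_of_lt hr)

theorem convexOn_radialPrimitive : ConvexOn ℝ (Ici 0) radialPrimitive := by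
  refine MonotoneOn.convexOn_of_deriv (convex_Ici 0)
    (fun r _ => (hasDerivAt_radialPrimitive r).continuousAt.continuousWithinAt)
    (fun r _ => (hasDerivAt_radialPrimitive r).differentiableAt.differentiableWithinAt) ?_
  rw [interior_Ici]
  have h : deriv radialPrimitive = radialSlope := funext fun r => (hasDerivAt_radialPrimitive r).deriv
  rw [h]
  exact monotoneOn_radialSlope.mono Ioi_subset_Ici_self

theorem mul_radialSlope_le_sub {r s : ℝ} (hr : 0 ≤ r) (hs : r ≤ s) :
    (s - r) * radialSlope r ≤ radialPrimitive s - radialPrimitive r := by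
  rw [radialPrimitive_sub]
  have := intervalIntegral.integral_mono_on hs (intervalIntegrable_const (μ := volume) (c := radialSlope r))
    (continuous_radialSlope.intervalIntegrable r s)
    (fun u hu => monotoneOn_radialSlope hr (mem_Ici.2 (hr.trans hu.1)) hu.1)
  simpa using this

theorem sub_le_mul_radialSlope {r s : ℝ} (hr : 0 ≤ r) (hs : r ≤ s) :
    radialPrimitive s - radialPrimitive r ≤ (s - r) * radialSlope s := by
  rw [radialPrimitive_sub]
  have := intervalIntegral.integral_mono_on hs
    (continuous_radialSlope.intervalIntegrable r s) (intervalIntegrable_const (μ := volume) (c := radialSlope s))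
    (fun u hu => monotoneOn_radialSlope (mem_Ici.2 (hr.trans hu.1)) (mem_Ici.2 (hr.trans hs)) hu.2)
  simpa using this

theorem radialPrimitive_nonneg {r : ℝ} (h : 0 ≤ r) : 0 ≤ radialPrimitive r := by
  rw [← radialPrimitive_zero]
  exact monotoneOn_radialPrimitive self_mem_Ici h h

/-- Only the integral over `[r/2, r]` is kept. This costs a constant factor and preserves the order
`r / log (1/r)` near zero. -/
theorem half_mul_radialSlope_le {r : ℝ} (h : 0 ≤ r) :
    r / 2 * radialSlope (r / 2) ≤ radialPrimitive r := by
  have h1 := mul_radialSlope_le_sub (r := r / 2) (s := r) (by linarith) (by linarith)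
  have h2 := radialPrimitive_nonneg (r := r / 2) (by linarith)
  rw [show r - r / 2 = r / 2 by ring] at h1
  linarith

theorem radialPrimitive_pos {r : ℝ} (h : 0 < r) : 0 < radialPrimitive r :=
  (mul_pos (half_pos h) (radialSlope_pos (half_pos h))).trans_le (half_mul_radialSlope_le h.le)

theorem radialPrimitive_le_mul {r : ℝ} (h : 0 ≤ r) : radialPrimitive r ≤ r * radialSlope r := by
  simpa [radialPrimitive_zero] using sub_le_mul_radialSlope le_rfl h

theorem hasGradientAt_radialPrimitive_norm {E : Type*} [NormedAddCommGroup E]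
    [InnerProductSpace ℝ E] [CompleteSpace E] (x : E) :
    HasGradientAt (fun y : E => radialPrimitive ‖y‖) ((radialSlope ‖x‖ / ‖x‖) • x) x := by
  rcases eq_or_ne x 0 with rfl | hx
  · have h1 := (hasDerivAt_radialPrimitive 0)
    rw [radialSlope_zero, hasDerivAt_iff_isLittleO] at h1
    have h2 : Tendsto (fun y : E => ‖y‖) (𝓝 0) (𝓝 0) := by
      simpa using (continuous_norm (E := E)).tendsto 0
    have h3 := h1.comp_tendsto h2
    rw [hasGradientAt_iff_isLittleO]
    refine Asymptotics.IsLittleO.of_norm_right ?_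
    simpa [Function.comp_def, radialPrimitive_zero] using h3
  · have hpos : 0 < ‖x‖ := norm_pos_iff.2 hx
    have h1 := ((hasStrictFDerivAt_norm_sq x).hasFDerivAt).sqrt (by positivity)
    simp only [Real.sqrt_sq (norm_nonneg _)] at h1
    have h2 := (hasDerivAt_radialPrimitive ‖x‖).comp_hasFDerivAt x h1
    rw [hasGradientAt_iff_hasFDerivAt]
    refine h2.congr_fderiv ?_
    ext y
    simp
    field_simp

theorem hasDerivAt_oneSidedQuadratic (a u : ℝ) :
    HasDerivAt (oneSidedQuadratic a) (max (u - a) 0) u := by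
  have h1 : HasDerivAt (fun v => oneSidedQuadratic a v - oneSidedQuadratic a u -
      max (u - a) 0 * (v - u)) 0 u := by
    rw [hasDerivAt_iff_hasFDerivAt]
    simp only [ContinuousLinearMap.toSpanSingleton_zero]
    -- The first-order Taylor remainder is at most `(v - u)²`, uniformly across the kink.
    refine Asymptotics.IsBigO.hasFDerivAt (n := 2)
      (Asymptotics.IsBigO.of_bound 1 (Eventually.of_forall fun v => ?_)) one_lt_two
    simp only [oneSidedQuadratic, norm_pow, Real.norm_eq_abs, one_mul, sq_abs]
    rw [abs_le]
    rcases max_cases (v - a) 0 with h | h <;> rcases max_cases (u - a) 0 with h' | h' <;>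
      rw [h.1, h'.1] <;> constructor <;> nlinarith
  have h2 := (h1.add (((hasDerivAt_id u).sub_const u).const_mul (max (u - a) 0))).add_const
    (oneSidedQuadratic a u)
  refine (h2.congr_deriv (by simp)).congr_of_eventuallyEq (Eventually.of_forall fun v => ?_)
  simp

end Profile

/-! ### The potential, its gradient and the truncated field. -/

section Potential

open Filter Topology

/-- The gradient of `almostRadialPotential 1 a`, with the radial factor `F'(r)/r` frozen inside the
ball of radius `ρ`. -/
noncomputable def truncatedGradient (a ρ : ℝ) (x : EuclideanSpace ℝ (Fin 2)) :
    EuclideanSpace ℝ (Fin 2) :=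
  (radialSlope (max ‖x‖ ρ) / max ‖x‖ ρ) • x + max (x 0 - a) 0 • EuclideanSpace.single 0 1

theorem truncatedGradient_eq {a ρ : ℝ} {x : EuclideanSpace ℝ (Fin 2)} (h : ρ ≤ ‖x‖) :
    truncatedGradient a ρ x = truncatedGradient a 0 x := by
  rw [truncatedGradient, truncatedGradient, max_eq_left h, max_eq_left (norm_nonneg x)]

theorem almostRadialPotential_one (a : ℝ) : almostRadialPotential 1 a =
    fun x => radialPrimitive ‖x‖ + oneSidedQuadratic a (x 0) := by
  ext x
  rw [almostRadialPotential, radialProfile_eq (norm_nonneg x), one_mul]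

theorem hasGradientAt_almostRadialPotential (a : ℝ) (x : EuclideanSpace ℝ (Fin 2)) :
    HasGradientAt (almostRadialPotential 1 a) (truncatedGradient a 0 x) x := by
  rw [almostRadialPotential_one]
  have h1 := (hasGradientAt_radialPrimitive_norm x).hasFDerivAt
  have h2 := (hasDerivAt_oneSidedQuadratic a (x 0)).comp_hasFDerivAt x
    (EuclideanSpace.proj (𝕜 := ℝ) (0 : Fin 2)).hasFDerivAt
  rw [hasGradientAt_iff_hasFDerivAt]
  refine (h1.add h2).congr_fderiv ?_
  ext y
  simp [truncatedGradient, EuclideanSpace.inner_single_left]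

/-- With `φ(r) = F'(r)/r` and `n ≤ m` the truncated norms, the radial difference is `φ(m)(x - y) +
(φ(m) - φ(n)) y`. Since `φ` decreases and `F'` increases, `|φ(m) - φ(n)| n ≤ φ(m)(m - n)`. Each
piece is thus at most `φ(m) ‖x - y‖`, with `φ(m) ≤ 1/(2ρ)`; the one-sided term has Lipschitz
constant `1`. -/
theorem norm_truncatedGradient_sub_le (a : ℝ) {ρ : ℝ} (hρ : 0 < ρ)
    (x y : EuclideanSpace ℝ (Fin 2)) :
    ‖truncatedGradient a ρ x - truncatedGradient a ρ y‖ ≤ (1 / ρ + 1) * ‖x - y‖ := by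
  have radial : ∀ x y : EuclideanSpace ℝ (Fin 2), ‖y‖ ≤ ‖x‖ →
      ‖(radialSlope (max ‖x‖ ρ) / max ‖x‖ ρ) • x - (radialSlope (max ‖y‖ ρ) / max ‖y‖ ρ) • y‖ ≤
        1 / ρ * ‖x - y‖ := by
    intro x y hxy
    set m := max ‖x‖ ρ
    set n := max ‖y‖ ρ
    have hn : 0 < n := hρ.trans_le (le_max_right _ _)
    have hnm : n ≤ m := max_le_max_right _ hxy
    have hm : 0 < m := hn.trans_le hnm
    have hmρ : ρ ≤ m := le_max_right _ _
    have hmn : m - n ≤ ‖x - y‖ := by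
      have h1 := norm_sub_norm_le x y
      rcases max_cases ‖x‖ ρ with h | h <;> rcases max_cases ‖y‖ ρ with h' | h' <;>
        simp only [m, n, h.1, h'.1] <;> linarith [norm_nonneg (x - y)]
    have hyn : ‖y‖ ≤ n := le_max_left _ _
    have hDm : radialSlope m ≤ 1 / 2 := radialSlope_le_half hm.le
    have hDm0 := radialSlope_nonneg hm.le
    have hDn0 := radialSlope_nonneg hn.le
    have hD : radialSlope n ≤ radialSlope m := monotoneOn_radialSlope hn.le hm.le hnm
    have hφm : radialSlope m / m ≤ 1 / 2 / ρ := div_le_div₀ (by norm_num) hDm hρ hmρ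
    have hφm0 : 0 ≤ radialSlope m / m := by positivity
    have h1 : (radialSlope m / m) • x - (radialSlope n / n) • y =
        (radialSlope m / m) • (x - y) + (radialSlope m / m - radialSlope n / n) • y := by
      module
    have hφ : radialSlope m / m ≤ radialSlope n / n := antitoneOn_radialSlope_div hn hm hnm
    have habs : |radialSlope m / m - radialSlope n / n| * ‖y‖ ≤ radialSlope m / m * (m - n) := by
      rw [abs_of_nonpos (by linarith)]
      have e1 : radialSlope n / n * n = radialSlope n := by field_simp
      have e2 : radialSlope m / m * m = radialSlope m := by field_simp
      nlinarith
    rw [h1]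
    refine (norm_add_le _ _).trans ?_
    rw [norm_smul, norm_smul, Real.norm_of_nonneg hφm0, Real.norm_eq_abs]
    have e3 : 1 / ρ = 1 / 2 / ρ + 1 / 2 / ρ := by ring
    have h2 := norm_nonneg (x - y)
    rw [e3, add_mul]
    refine add_le_add (mul_le_mul_of_nonneg_right hφm h2) (habs.trans ?_)
    exact mul_le_mul hφm hmn (by linarith) (by positivity)
  have hsplit : truncatedGradient a ρ x - truncatedGradient a ρ y =
      ((radialSlope (max ‖x‖ ρ) / max ‖x‖ ρ) • x - (radialSlope (max ‖y‖ ρ) / max ‖y‖ ρ) • y) +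
        (max (x 0 - a) 0 - max (y 0 - a) 0) • EuclideanSpace.single 0 1 := by
    unfold truncatedGradient
    module
  rw [hsplit, add_mul, one_mul]
  refine (norm_add_le _ _).trans (add_le_add ?_ ?_)
  · rcases le_total ‖y‖ ‖x‖ with h | h
    · exact radial x y h
    · rw [norm_sub_rev, norm_sub_rev x y]
      exact radial y x h
  · rw [norm_smul, PiLp.norm_single, norm_one, mul_one, Real.norm_eq_abs]
    refine (abs_max_sub_max_le_abs _ _ _).trans ?_
    rw [sub_sub_sub_cancel_right]
    exact PiLp.norm_apply_le (x - y) 0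

theorem continuous_truncatedGradient (a : ℝ) {ρ : ℝ → ℝ} (hρ : Continuous ρ)
    (hpos : ∀ t, 0 < ρ t) :
    Continuous (Function.uncurry fun t x => truncatedGradient a (ρ t) x) := by
  have h := continuous_radialSlope
  have hne : ∀ z : ℝ × EuclideanSpace ℝ (Fin 2), max ‖z.2‖ (ρ z.1) ≠ 0 :=
    fun z => ((hpos z.1).trans_le (le_max_right _ _)).ne'
  have hm : Continuous fun z : ℝ × EuclideanSpace ℝ (Fin 2) => max ‖z.2‖ (ρ z.1) := by fun_prop
  have h1 := (h.comp hm).div hm hne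
  unfold Function.uncurry truncatedGradient
  exact (h1.smul continuous_snd).add (by fun_prop)

theorem continuous_gradientField (a : ℝ) : Continuous (truncatedGradient a 0) := by
  have hrad : Continuous fun x : EuclideanSpace ℝ (Fin 2) => (radialSlope ‖x‖ / ‖x‖) • x := by
    rw [continuous_iff_continuousAt]
    intro x
    have hD : Continuous fun x : EuclideanSpace ℝ (Fin 2) => radialSlope ‖x‖ :=
      continuous_radialSlope.comp continuous_norm
    rcases eq_or_ne x 0 with rfl | hx
    · rw [ContinuousAt, smul_zero, tendsto_zero_iff_norm_tendsto_zero]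
      have h0 := hD.tendsto 0
      rw [norm_zero, radialSlope_zero] at h0
      refine squeeze_zero (fun _ => norm_nonneg _) (fun y => ?_) h0
      have h1 := radialSlope_nonneg (norm_nonneg y)
      rw [norm_smul, Real.norm_of_nonneg (by positivity)]
      rcases eq_or_ne ‖y‖ 0 with h | h
      · rw [h, mul_zero, radialSlope_zero]
      · rw [div_mul_cancel₀ _ h]
    · exact (hD.continuousAt.div continuous_norm.continuousAt (norm_ne_zero_iff.2 hx)).smul
        continuousAt_id
  have h2 : truncatedGradient a 0 = fun x => (radialSlope ‖x‖ / ‖x‖) • x +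
      max (x 0 - a) 0 • EuclideanSpace.single 0 1 := by
    ext1 x
    rw [truncatedGradient, max_eq_left (norm_nonneg x)]
  rw [h2]
  exact hrad.add (by fun_prop)

theorem contDiff_almostRadialPotential (a : ℝ) : ContDiff ℝ 1 (almostRadialPotential 1 a) := by
  rw [contDiff_one_iff_hasFDerivAt]
  exact ⟨_, (InnerProductSpace.toDual ℝ _).continuous.comp (continuous_gradientField a),
    fun x => (hasGradientAt_almostRadialPotential a x).hasFDerivAt⟩

theorem convexOn_almostRadialPotential (a : ℝ) :
    ConvexOn ℝ univ (almostRadialPotential 1 a) := by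
  rw [almostRadialPotential_one]
  refine ConvexOn.add ?_ ?_
  · refine ConvexOn.comp (convexOn_radialPrimitive.subset ?_ ?_) (convexOn_norm convex_univ)
      (monotoneOn_radialPrimitive.mono ?_)
    · rintro _ ⟨x, -, rfl⟩
      exact norm_nonneg x
    · rw [image_univ]
      have : range (fun x : EuclideanSpace ℝ (Fin 2) => ‖x‖) = Ici 0 := range_norm _
      rw [this]
      exact convex_Ici 0
    · rintro _ ⟨x, -, rfl⟩
      exact norm_nonneg x
  · have h1 : ConvexOn ℝ univ (oneSidedQuadratic a) := by
      have h : deriv (oneSidedQuadratic a) = fun u => max (u - a) 0 :=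
        funext fun u => (hasDerivAt_oneSidedQuadratic a u).deriv
      refine Monotone.convexOn_univ_of_deriv
        (fun u => (hasDerivAt_oneSidedQuadratic a u).differentiableAt) ?_
      rw [h]
      intro u v huv
      exact max_le_max_right _ (by linarith)
    exact h1.comp_linearMap (EuclideanSpace.proj (𝕜 := ℝ) (0 : Fin 2)).toLinearMap

theorem oneSidedQuadratic_nonneg (a u : ℝ) : 0 ≤ oneSidedQuadratic a u := by
  unfold oneSidedQuadratic
  positivity

theorem almostRadialPotential_zero {a : ℝ} (ha : 0 < a) : almostRadialPotential 1 a 0 = 0 := by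
  simp [almostRadialPotential_one, radialPrimitive_zero, oneSidedQuadratic, ha.le]

theorem radialPrimitive_norm_le (a : ℝ) (x : EuclideanSpace ℝ (Fin 2)) :
    radialPrimitive ‖x‖ ≤ almostRadialPotential 1 a x := by
  rw [almostRadialPotential_one]
  linarith [oneSidedQuadratic_nonneg a (x 0)]

theorem isMinOn_almostRadialPotential_iff {a : ℝ} (ha : 0 < a) (x : EuclideanSpace ℝ (Fin 2)) :
    IsMinOn (almostRadialPotential 1 a) univ x ↔ x = 0 := by
  constructor
  · intro h
    by_contra hx
    have h1 := h (mem_univ 0)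
    have h2 := radialPrimitive_norm_le a x
    have h3 := radialPrimitive_pos (norm_pos_iff.2 hx)
    simp only [mem_ofPred_eq, almostRadialPotential_zero ha] at h1
    linarith
  · rintro rfl y -
    simp only [mem_ofPred_eq, almostRadialPotential_zero ha]
    exact (radialPrimitive_nonneg (norm_nonneg y)).trans (radialPrimitive_norm_le a y)

/-- This is the convexity inequality against the minimizer, checked term by term; it makes the
Lyapunov function nonincreasing. -/
theorem almostRadialPotential_le_inner {a : ℝ} (ha : 0 < a) (x : EuclideanSpace ℝ (Fin 2)) :
    almostRadialPotential 1 a x ≤ inner ℝ (truncatedGradient a 0 x) x := by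
  have h1 : inner ℝ (truncatedGradient a 0 x) x =
      ‖x‖ * radialSlope ‖x‖ + max (x 0 - a) 0 * x 0 := by
    rw [truncatedGradient, max_eq_left (norm_nonneg x), inner_add_left, real_inner_smul_left,
      real_inner_smul_left, real_inner_self_eq_norm_sq, EuclideanSpace.inner_single_left]
    simp only [map_one, one_mul]
    rcases eq_or_ne ‖x‖ 0 with h | h
    · simp [h]
    · field_simp
  rw [h1, almostRadialPotential_one]
  refine add_le_add (radialPrimitive_le_mul (norm_nonneg x)) ?_
  unfold oneSidedQuadratic
  rcases max_cases (x 0 - a) 0 with h | h <;> rw [h.1] <;> nlinarith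

end Potential

/-! ### Global existence by a weighted contraction. -/

section Existence

open Filter Topology NNReal BoundedContinuousFunction

variable {E : Type*} [NormedAddCommGroup E] [NormedSpace ℝ E]

/-- `u⁻³ ∫₀ᵘ s³ g(s) ds`, written so that it is manifestly continuous at `u = 0`. -/
noncomputable def cubicMean (g : ℝ → E) (u : ℝ) : E :=
  u • ∫ σ in (0 : ℝ)..1, σ ^ 3 • g (u * σ)

theorem continuous_cubicMean {g : ℝ → E} (hg : Continuous g) : Continuous (cubicMean g) := by
  unfold cubicMean
  refine continuous_id.smul ?_
  exact intervalIntegral.continuous_parametric_intervalIntegral_of_continuous' (by fun_prop) 0 1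

theorem cubicMean_zero (g : ℝ → E) : cubicMean g 0 = 0 := by simp [cubicMean]

theorem pow_three_smul_cubicMean (g : ℝ → E) (u : ℝ) :
    u ^ 3 • cubicMean g u = ∫ s in (0 : ℝ)..u, s ^ 3 • g s := by
  have h := intervalIntegral.smul_integral_comp_mul_left (a := 0) (b := 1)
    (fun s : ℝ => s ^ 3 • g s) u
  simp only [mul_zero, mul_one] at h
  rw [← h, cubicMean, smul_comm]
  congr 1
  rw [← intervalIntegral.integral_smul]
  congr 1
  ext σ
  rw [smul_smul, mul_pow]

/-- The factor `t³` integrates the damping, so `V = -cubicMean g` solves `V' + (3/t) V = -g` with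
`V(0) = 0`. -/
theorem hasDerivAt_cubicMean [CompleteSpace E] {g : ℝ → E} (hg : Continuous g) {t : ℝ}
    (ht : 0 < t) : HasDerivAt (cubicMean g) (g t - (3 / t) • cubicMean g t) t := by
  have hI : HasDerivAt (fun u => ∫ s in (0 : ℝ)..u, s ^ 3 • g s) (t ^ 3 • g t) t := by
    have hc : Continuous (fun s : ℝ => s ^ 3 • g s) := by fun_prop
    exact intervalIntegral.integral_hasDerivAt_right (hc.intervalIntegrable _ _)
      hc.stronglyMeasurable.stronglyMeasurableAtFilter hc.continuousAt
  have hp : HasDerivAt (fun u : ℝ => (u ^ 3)⁻¹) (-(3 * t ^ 2) / (t ^ 3) ^ 2) t := by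
    have := (hasDerivAt_pow 3 t).inv (by positivity)
    exact this.congr_deriv (by norm_num)
  have h := hp.smul hI
  refine (h.congr_deriv ?_).congr_of_eventuallyEq ?_
  · rw [← pow_three_smul_cubicMean, smul_smul, smul_smul, inv_mul_cancel₀ (by positivity), one_smul,
      sub_eq_add_neg, ← neg_smul]
    congr 2
    field_simp
  · filter_upwards [lt_mem_nhds ht] with u hu
    simp only [Pi.smul_apply']
    rw [← pow_three_smul_cubicMean, smul_smul, inv_mul_cancel₀ (by positivity), one_smul]

theorem cubicMean_sub {g h : ℝ → E} (hg : Continuous g) (hh : Continuous h) (u : ℝ) :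
    cubicMean (fun s => g s - h s) u = cubicMean g u - cubicMean h u := by
  unfold cubicMean
  rw [← smul_sub, ← intervalIntegral.integral_sub]
  · simp only [smul_sub]
  · exact Continuous.intervalIntegrable (by fun_prop) _ _
  · exact Continuous.intervalIntegrable (by fun_prop) _ _

theorem norm_cubicMean_le {g : ℝ → E} {u C : ℝ} (hu : 0 ≤ u)
    (h : ∀ s ∈ Icc 0 u, ‖g s‖ ≤ C) : ‖cubicMean g u‖ ≤ u * C := by
  unfold cubicMean
  rw [norm_smul, Real.norm_of_nonneg hu]
  refine mul_le_mul_of_nonneg_left ?_ hu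
  have := intervalIntegral.norm_integral_le_of_norm_le_const (a := (0 : ℝ)) (b := 1) (C := C)
    (f := fun σ => σ ^ 3 • g (u * σ)) ?_
  · simpa using this
  · intro σ hσ
    rw [uIoc_of_le zero_le_one] at hσ
    have h1 : ‖g (u * σ)‖ ≤ C := h _ ⟨by have := hσ.1.le; positivity,
      by nlinarith [hσ.2]⟩
    rw [norm_smul, Real.norm_of_nonneg (pow_nonneg hσ.1.le 3)]
    have h3 : σ ^ 3 ≤ 1 := pow_le_one₀ hσ.1.le hσ.2
    nlinarith [norm_nonneg (g (u * σ))]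

/-- The exponential weight with logarithmic derivative `2 t ℓ(t)`. -/
noncomputable def expWeight (ℓ : ℝ → ℝ) (t : ℝ) : ℝ := Real.exp (∫ s in (0 : ℝ)..t, 2 * s * ℓ s)

theorem expWeight_pos (ℓ : ℝ → ℝ) (t : ℝ) : 0 < expWeight ℓ t := Real.exp_pos _

theorem hasDerivAt_expWeight {ℓ : ℝ → ℝ} (hℓ : Continuous ℓ) (t : ℝ) :
    HasDerivAt (expWeight ℓ) (expWeight ℓ t * (2 * t * ℓ t)) t := by
  have hc : Continuous (fun s : ℝ => 2 * s * ℓ s) := by fun_prop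
  exact (intervalIntegral.integral_hasDerivAt_right (hc.intervalIntegrable _ _)
      hc.stronglyMeasurable.stronglyMeasurableAtFilter hc.continuousAt).exp

theorem continuous_expWeight {ℓ : ℝ → ℝ} (hℓ : Continuous ℓ) : Continuous (expWeight ℓ) :=
  continuous_iff_continuousAt.2 fun t => (hasDerivAt_expWeight hℓ t).continuousAt

theorem expWeight_mono {ℓ : ℝ → ℝ} (hℓ : Continuous ℓ) (h0 : ∀ t, 0 ≤ t → 0 ≤ ℓ t) :
    MonotoneOn (expWeight ℓ) (Ici 0) := by
  refine monotoneOn_of_deriv_nonneg (convex_Ici 0) (continuous_expWeight hℓ).continuousOn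
    (fun t _ => (hasDerivAt_expWeight hℓ t).differentiableAt.differentiableWithinAt) ?_
  intro t ht
  rw [interior_Ici] at ht
  rw [(hasDerivAt_expWeight hℓ t).deriv]
  have := expWeight_pos ℓ t
  have := h0 t (le_of_lt ht)
  have : 0 < t := ht
  positivity

/-- By monotonicity of `ℓ` and the weight `W`, the integrand is at most `u ℓ(u) W(u) C = W'(u) C /
2`. The weight was chosen to make this exact, yielding contraction factor `1/2` on the whole
half-line. -/
theorem norm_integral_cubicMean_le {ℓ : ℝ → ℝ} (hℓ : Continuous ℓ)
    (hmono : MonotoneOn ℓ (Ici 0)) (h0 : ∀ t, 0 ≤ t → 0 ≤ ℓ t) {g : ℝ → E}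
    {C : ℝ} (hC : 0 ≤ C) (h : ∀ s, 0 ≤ s → ‖g s‖ ≤ ℓ s * expWeight ℓ s * C) {t : ℝ} (ht : 0 ≤ t) :
    ‖∫ u in (0 : ℝ)..t, cubicMean g u‖ ≤ expWeight ℓ t * (1 / 2 * C) := by
  have hW := continuous_expWeight hℓ
  have h1 : ‖∫ u in (0 : ℝ)..t, cubicMean g u‖ ≤
      ∫ u in (0 : ℝ)..t, expWeight ℓ u * (2 * u * ℓ u) * (1 / 2 * C) := by
    refine intervalIntegral.norm_integral_le_of_norm_le ht ?_
      (Continuous.intervalIntegrable (by fun_prop) _ _)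
    refine ae_of_all _ fun u hu => ?_
    have hu0 : 0 ≤ u := hu.1.le
    have := norm_cubicMean_le (g := g) (C := ℓ u * expWeight ℓ u * C) hu0 ?_
    · linarith
    · intro s hs
      refine (h s hs.1).trans ?_
      have := hmono hs.1 hu0 hs.2
      have := expWeight_mono hℓ h0 hs.1 hu0 hs.2
      have := (expWeight_pos ℓ s).le
      have := h0 s hs.1
      have := h0 u hu0
      gcongr
  have h2 : ∫ u in (0 : ℝ)..t, expWeight ℓ u * (2 * u * ℓ u) * (1 / 2 * C) =
      (expWeight ℓ t - expWeight ℓ 0) * (1 / 2 * C) := by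
    rw [intervalIntegral.integral_mul_const,
      intervalIntegral.integral_eq_sub_of_hasDerivAt
        (fun u _ => hasDerivAt_expWeight hℓ u)
        (Continuous.intervalIntegrable (by fun_prop) _ _)]
  rw [h2] at h1
  have := (expWeight_pos ℓ 0).le
  nlinarith [mul_nonneg this hC]

/-- Global existence for `X'' + (3/t) X' + G(t, X) = 0`, `X(0) = X₀`, `X'(0) = 0`, when `G` is
Lipschitz in space with a constant that is locally bounded in time. -/
theorem exists_solution_of_lipschitz [CompleteSpace E] {G : ℝ → E → E}
    (hG : Continuous (Function.uncurry G)) {ℓ : ℝ → ℝ} (hℓ : Continuous ℓ)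
    (hmono : MonotoneOn ℓ (Ici 0)) (h0 : ∀ t, 0 ≤ t → 0 ≤ ℓ t)
    (hlip : ∀ t, 0 ≤ t → ∀ x y, ‖G t x - G t y‖ ≤ ℓ t * ‖x - y‖) (X₀ : E)
    (hX₀ : ∀ t, 0 ≤ t → ‖G t X₀‖ ≤ ℓ t) :
    ∃ X V : ℝ → E, Continuous V ∧ (∀ t, HasDerivAt X (V t) t) ∧ X 0 = X₀ ∧ V 0 = 0 ∧
      ∀ t, 0 < t → HasDerivAt V (-((3 / t) • V t) - G t (X t)) t := by
  have hW := continuous_expWeight hℓ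
  have hWpos := expWeight_pos ℓ
  have hW1 : ∀ t, 0 ≤ t → 1 ≤ expWeight ℓ t := fun t ht => by
    have := expWeight_mono hℓ h0 (self_mem_Ici (a := (0 : ℝ))) ht ht
    simpa [expWeight] using this
  -- The unknown is `Z = (X - X₀) / W`, so the plain sup norm of `Z` is a weighted norm of `X - X₀`.
  let g : (ℝ≥0 →ᵇ E) → ℝ → E := fun Z s => G s (X₀ + expWeight ℓ s • Z s.toNNReal)
  have hg : ∀ Z, Continuous (g Z) := fun Z => by
    have h1 : Continuous fun s : ℝ => X₀ + expWeight ℓ s • Z s.toNNReal :=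
      continuous_const.add (hW.smul (Z.continuous.comp continuous_real_toNNReal))
    exact hG.comp (continuous_id.prodMk h1)
  have hgsub : ∀ Z Z', ∀ s, 0 ≤ s → ‖g Z s - g Z' s‖ ≤ ℓ s * expWeight ℓ s * ‖Z - Z'‖ := by
    intro Z Z' s hs
    refine (hlip s hs _ _).trans ?_
    rw [mul_assoc]
    refine mul_le_mul_of_nonneg_left ?_ (h0 s hs)
    rw [add_sub_add_left_eq_sub, ← smul_sub, norm_smul, Real.norm_of_nonneg (hWpos s).le]
    exact mul_le_mul_of_nonneg_left ((Z - Z').norm_coe_le_norm _) (hWpos s).le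
  have hgbd : ∀ Z, ∀ s, 0 ≤ s → ‖g Z s‖ ≤ ℓ s * expWeight ℓ s * (1 + ‖Z‖) := by
    intro Z s hs
    have h1 := hgsub Z 0 s hs
    have h2 : g 0 s = G s X₀ := by simp [g]
    rw [h2, sub_zero] at h1
    have h3 := norm_le_norm_sub_add (g Z s) (G s X₀)
    have h4 := hX₀ s hs
    have h5 := hW1 s hs
    nlinarith [h0 s hs]
  let I : (ℝ≥0 →ᵇ E) → ℝ → E := fun Z t => ∫ u in (0 : ℝ)..t, cubicMean (g Z) u
  have hI : ∀ Z t, HasDerivAt (I Z) (cubicMean (g Z) t) t := fun Z t => by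
    have hc := continuous_cubicMean (hg Z)
    exact intervalIntegral.integral_hasDerivAt_right (hc.intervalIntegrable _ _)
      hc.stronglyMeasurable.stronglyMeasurableAtFilter hc.continuousAt
  have hIc : ∀ Z, Continuous (I Z) := fun Z =>
    continuous_iff_continuousAt.2 fun t => (hI Z t).continuousAt
  have hscale : ∀ (t : ℝ) (x : E) (B : ℝ), ‖x‖ ≤ expWeight ℓ t * B →
      ‖-((expWeight ℓ t)⁻¹ • x)‖ ≤ B := by
    intro t x B h
    rw [norm_neg, norm_smul, norm_inv, Real.norm_of_nonneg (hWpos t).le,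
      inv_mul_le_iff₀ (hWpos t)]
    exact h
  let Φ : (ℝ≥0 →ᵇ E) → (ℝ≥0 →ᵇ E) := fun Z =>
    BoundedContinuousFunction.ofNormedAddCommGroup
      (fun t : ℝ≥0 => -((expWeight ℓ t)⁻¹ • I Z t))
      (by
        have h1 : Continuous fun t : ℝ => -((expWeight ℓ t)⁻¹ • I Z t) :=
          ((hW.inv₀ fun t => (hWpos t).ne').smul (hIc Z)).neg
        exact h1.comp NNReal.continuous_coe)
      (1 / 2 * (1 + ‖Z‖))
      (fun t => hscale t _ _ (norm_integral_cubicMean_le hℓ hmono h0 (by positivity)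
        (hgbd Z) t.2))
  have hΦ : ContractingWith (1 / 2 : ℝ≥0) Φ := by
    refine ⟨by rw [← NNReal.coe_lt_coe]; norm_num, LipschitzWith.of_dist_le_mul fun Z Z' => ?_⟩
    rw [BoundedContinuousFunction.dist_le (by positivity)]
    intro t
    have h1 : Φ Z t - Φ Z' t =
        -((expWeight ℓ t)⁻¹ • ∫ u in (0 : ℝ)..t, cubicMean (fun s => g Z s - g Z' s) u) := by
      simp only [cubicMean_sub (hg Z) (hg Z')]
      rw [intervalIntegral.integral_sub
        ((continuous_cubicMean (hg Z)).intervalIntegrable _ _)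
        ((continuous_cubicMean (hg Z')).intervalIntegrable _ _), smul_sub]
      simp only [Φ, I, BoundedContinuousFunction.coe_ofNormedAddCommGroup]
      abel
    rw [dist_eq_norm, h1, dist_eq_norm]
    refine hscale _ _ _ ?_
    simpa [Pi.sub_def] using norm_integral_cubicMean_le hℓ hmono h0 (norm_nonneg (Z - Z'))
      (hgsub Z Z') t.2
  obtain ⟨Z, hZ⟩ : ∃ Z, Φ Z = Z := ⟨_, hΦ.fixedPoint_isFixedPt⟩
  have hfix : ∀ t : ℝ, 0 ≤ t → expWeight ℓ t • Z t.toNNReal = -I Z t := by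
    intro t ht
    have h1 : Z t.toNNReal = -((expWeight ℓ t)⁻¹ • I Z t) := by
      conv_lhs => rw [← hZ]
      simp only [Φ, BoundedContinuousFunction.coe_ofNormedAddCommGroup, Real.coe_toNNReal t ht]
    rw [h1, smul_neg, smul_smul, mul_inv_cancel₀ (hWpos t).ne', one_smul]
  refine ⟨fun t => X₀ - I Z t, fun t => -cubicMean (g Z) t, (continuous_cubicMean (hg Z)).neg,
    fun t => (hI Z t).const_sub X₀, by simp [I], by simp [cubicMean_zero], fun t ht => ?_⟩
  refine (hasDerivAt_cubicMean (hg Z) ht).neg.congr_deriv ?_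
  have h1 : g Z t = G t (X₀ - I Z t) := by
    simp only [g]
    rw [hfix t ht.le, sub_eq_add_neg]
  rw [h1, smul_neg]
  abel

end Existence

/-! ### Scalar comparison for the damped equation. -/

section Comparison

theorem le_of_hasDerivAt_nonpos {f f' : ℝ → ℝ} {s t : ℝ} (hst : s ≤ t)
    (hf : ContinuousOn f (Icc s t)) (hf' : ∀ x ∈ Ioo s t, HasDerivAt f (f' x) x)
    (h : ∀ x ∈ Ioo s t, f' x ≤ 0) : f t ≤ f s := by
  refine antitoneOn_of_deriv_nonpos (convex_Icc s t) hf ?_ ?_ (left_mem_Icc.2 hst)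
    (right_mem_Icc.2 hst) hst
  · rw [interior_Icc]
    exact fun x hx => (hf' x hx).differentiableAt.differentiableWithinAt
  · rw [interior_Icc]
    exact fun x hx => (hf' x hx).deriv ▸ h x hx

/-- Integrate `(s³ u)' = -s³ h ≤ -g s³`. -/
theorem damped_velocity_le {u h : ℝ → ℝ} {g t : ℝ} (ht : 0 ≤ t) (hu : Continuous u)
    (hu0 : u 0 = 0) (hu' : ∀ s ∈ Ioo 0 t, HasDerivAt u (-(3 / s * u s) - h s) s)
    (hg : ∀ s ∈ Ioo 0 t, g ≤ h s) : u t ≤ -(g * t / 4) := by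
  rcases ht.eq_or_lt with rfl | ht
  · simp [hu0]
  have h1 := le_of_hasDerivAt_nonpos (f := fun s => s ^ 3 * u s + g * s ^ 4 / 4)
    (f' := fun s => s ^ 3 * (g - h s)) ht.le (by fun_prop) ?_ ?_
  · simp only [hu0] at h1
    have : t ^ 3 * (u t + g * t / 4) ≤ 0 := by nlinarith
    have := nonpos_of_mul_nonpos_right this (by positivity)
    linarith
  · intro s hs
    have hs0 : s ≠ 0 := hs.1.ne'
    refine (((hasDerivAt_pow 3 s).mul (hu' s hs)).add
      (((hasDerivAt_pow 4 s).const_mul g).div_const 4)).congr_deriv ?_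
    push_cast
    field_simp
    ring
  · intro s hs
    exact mul_nonpos_of_nonneg_of_nonpos (pow_nonneg hs.1.le 3) (by linarith [hg s hs])

theorem damped_position_le {p u h : ℝ → ℝ} {g t : ℝ} (ht : 0 ≤ t) (hp : ∀ s, HasDerivAt p (u s) s)
    (hu : Continuous u) (hu0 : u 0 = 0)
    (hu' : ∀ s ∈ Ioo 0 t, HasDerivAt u (-(3 / s * u s) - h s) s)
    (hg : ∀ s ∈ Ioo 0 t, g ≤ h s) : p t ≤ p 0 - g * t ^ 2 / 8 := by
  have hpc : Continuous p := continuous_iff_continuousAt.2 fun s => (hp s).continuousAt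
  have h1 := le_of_hasDerivAt_nonpos (f := fun s => p s + g * s ^ 2 / 8)
    (f' := fun s => u s + g * s / 4) ht (by fun_prop) ?_ ?_
  · linarith
  · intro s _
    refine ((hp s).add (((hasDerivAt_pow 2 s).const_mul g).div_const 8)).congr_deriv ?_
    push_cast
    ring
  · intro s hs
    have := damped_velocity_le hs.1.le hu hu0
      (fun x hx => hu' x ⟨hx.1, hx.2.trans hs.2⟩) (fun x hx => hg x ⟨hx.1, hx.2.trans hs.2⟩)
    linarith

theorem damped_position_ge {p u h : ℝ → ℝ} {g t : ℝ} (ht : 0 ≤ t) (hp : ∀ s, HasDerivAt p (u s) s)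
    (hu : Continuous u) (hu0 : u 0 = 0)
    (hu' : ∀ s ∈ Ioo 0 t, HasDerivAt u (-(3 / s * u s) - h s) s)
    (hg : ∀ s ∈ Ioo 0 t, h s ≤ g) : p 0 - g * t ^ 2 / 8 ≤ p t := by
  have := damped_position_le (p := fun s => -p s) (u := fun s => -u s) (h := fun s => -h s)
    (g := -g) ht (fun s => (hp s).neg) hu.neg (by simp [hu0])
    (fun s hs => (hu' s hs).neg.congr_deriv (by ring)) (fun s hs => neg_le_neg (hg s hs))
  linarith

theorem exists_first_nonpos {φ : ℝ → ℝ} (hφ : Continuous φ) {s : ℝ} (hs : 0 ≤ s) (h : φ s ≤ 0) :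
    ∃ T ∈ Icc 0 s, φ T ≤ 0 ∧ ∀ x ∈ Ico 0 T, 0 < φ x := by
  have hK : IsCompact (Icc 0 s ∩ {x | φ x ≤ 0}) :=
    isCompact_Icc.inter_right (isClosed_le hφ continuous_const)
  obtain ⟨T, hT, hmin⟩ := hK.exists_isLeast ⟨s, ⟨hs, le_rfl⟩, h⟩
  refine ⟨T, hT.1, hT.2, fun x hx => ?_⟩
  by_contra hc
  exact absurd (hmin ⟨⟨hx.1, hx.2.le.trans hT.1.2⟩, not_lt.1 hc⟩) (not_le.2 hx.2)

end Comparison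

/-! ### Energy and position estimates for the launched trajectory. -/

section Trajectory

/-- The threshold at which the one-sided quadratic becomes active. -/
noncomputable def threshold : ℝ := 24 / 25

theorem threshold_eq : threshold = 24 / 25 := rfl

theorem threshold_pos : 0 < threshold := by norm_num [threshold]

/-- The initial position `(1, 1/5)`. -/
noncomputable def launchPoint : EuclideanSpace ℝ (Fin 2) := !₂[1, 1 / 5]

/-- `X`, with velocity `V`, starts at rest at `launchPoint` and solves the Nesterov equation for
`almostRadialPotential 1 threshold` on `(0, τ)`. -/
structure IsLaunchedTrajectory (X V : ℝ → EuclideanSpace ℝ (Fin 2)) (τ : ℝ) : Prop where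
  position : ∀ t, HasDerivAt X (V t) t
  continuous_velocity : Continuous V
  position_zero : X 0 = launchPoint
  velocity_zero : V 0 = 0
  velocity : ∀ t ∈ Ioo 0 τ,
    HasDerivAt V (-((3 / t) • V t) - truncatedGradient threshold 0 (X t)) t

theorem norm_launchPoint_bounds : 1 ≤ ‖launchPoint‖ ∧ ‖launchPoint‖ ≤ 51 / 50 := by
  have h : ‖launchPoint‖ ^ 2 = 26 / 25 := by
    rw [EuclideanSpace.real_norm_sq_eq, Fin.sum_univ_two]
    norm_num [launchPoint]
  constructor <;> nlinarith [norm_nonneg launchPoint]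

theorem exp_neg_two_lt : Real.exp (-2) < 1 / 2 := by
  have h := Real.add_one_lt_exp (x := 2) (by norm_num)
  rw [Real.exp_neg, inv_eq_one_div]
  exact one_div_lt_one_div_of_lt two_pos (by linarith)

/-- The mechanical energy. -/
noncomputable def mechanicalEnergy (X V : ℝ → EuclideanSpace ℝ (Fin 2)) (t : ℝ) : ℝ :=
  1 / 2 * ‖V t‖ ^ 2 + almostRadialPotential 1 threshold (X t)

namespace IsLaunchedTrajectory

variable {X V : ℝ → EuclideanSpace ℝ (Fin 2)} {τ : ℝ}

theorem mono (h : IsLaunchedTrajectory X V τ) {t : ℝ} (ht : t ≤ τ) :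
    IsLaunchedTrajectory X V t :=
  { h with velocity := fun s hs => h.velocity s ⟨hs.1, hs.2.trans_le ht⟩ }

theorem continuous_position (h : IsLaunchedTrajectory X V τ) : Continuous X :=
  continuous_iff_continuousAt.2 fun s => (h.position s).continuousAt

theorem position_apply (h : IsLaunchedTrajectory X V τ) (i : Fin 2) (t : ℝ) :
    HasDerivAt (fun s => X s i) (V t i) t :=
  (EuclideanSpace.proj (𝕜 := ℝ) i).hasFDerivAt.comp_hasDerivAt t (h.position t)

theorem velocity_apply (h : IsLaunchedTrajectory X V τ) (i : Fin 2) :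
    ∀ t ∈ Ioo 0 τ, HasDerivAt (fun s => V s i)
      (-(3 / t * V t i) - truncatedGradient threshold 0 (X t) i) t := fun t ht =>
  (EuclideanSpace.proj (𝕜 := ℝ) i).hasFDerivAt.comp_hasDerivAt t (h.velocity t ht)

theorem continuous_velocity_apply (h : IsLaunchedTrajectory X V τ) (i : Fin 2) :
    Continuous fun s => V s i :=
  (EuclideanSpace.proj (𝕜 := ℝ) i).continuous.comp h.continuous_velocity

theorem velocity_zero_apply (h : IsLaunchedTrajectory X V τ) (i : Fin 2) : V 0 i = 0 := by
  rw [h.velocity_zero]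
  rfl

theorem hasDerivAt_mechanicalEnergy (h : IsLaunchedTrajectory X V τ) {t : ℝ} (ht : t ∈ Ioo 0 τ) :
    HasDerivAt (mechanicalEnergy X V) (-(3 / t * ‖V t‖ ^ 2)) t := by
  have h1 := (h.velocity t ht).norm_sq.const_mul (1 / 2)
  have h2 := (hasGradientAt_almostRadialPotential threshold (X t)).hasFDerivAt.comp_hasDerivAt t
    (h.position t)
  refine (h1.add h2).congr_deriv ?_
  rw [InnerProductSpace.toDual_apply_apply, inner_sub_right, inner_neg_right, inner_smul_right,
    real_inner_self_eq_norm_sq, real_inner_comm (V t)]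
  ring

theorem continuous_mechanicalEnergy (h : IsLaunchedTrajectory X V τ) :
    Continuous (mechanicalEnergy X V) := by
  have h1 := h.continuous_velocity
  have h2 := (contDiff_almostRadialPotential threshold).continuous.comp h.continuous_position
  unfold mechanicalEnergy
  exact (by fun_prop : Continuous fun t => 1 / 2 * ‖V t‖ ^ 2).add h2

theorem mechanicalEnergy_le (h : IsLaunchedTrajectory X V τ) {s t : ℝ} (hs : 0 ≤ s) (hst : s ≤ t)
    (ht : t ≤ τ) : mechanicalEnergy X V t ≤ mechanicalEnergy X V s := by
  refine le_of_hasDerivAt_nonpos hst h.continuous_mechanicalEnergy.continuousOn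
    (fun x hx => h.hasDerivAt_mechanicalEnergy ⟨hs.trans_lt hx.1, hx.2.trans_le ht⟩) ?_
  intro x hx
  have : 0 < x := hs.trans_lt hx.1
  have : 0 ≤ 3 / x * ‖V x‖ ^ 2 := by positivity
  linarith

/-- The surplus `1/1250` is `(1 - 24/25)² / 2`. -/
theorem mechanicalEnergy_zero (h : IsLaunchedTrajectory X V τ) :
    mechanicalEnergy X V 0 = radialPrimitive ‖launchPoint‖ + 1 / 1250 := by
  rw [mechanicalEnergy, h.velocity_zero, h.position_zero, almostRadialPotential_one]
  norm_num [launchPoint, oneSidedQuadratic, threshold]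

theorem radialPrimitive_norm_le (h : IsLaunchedTrajectory X V τ) (hτ : 0 ≤ τ) :
    radialPrimitive ‖X τ‖ ≤ radialPrimitive ‖launchPoint‖ + 1 / 1250 := by
  have h1 := h.mechanicalEnergy_le le_rfl hτ le_rfl
  have h2 := _root_.radialPrimitive_norm_le threshold (X τ)
  rw [h.mechanicalEnergy_zero, mechanicalEnergy] at h1
  nlinarith [sq_nonneg ‖V τ‖]

theorem norm_position_le (h : IsLaunchedTrajectory X V τ) (hτ : 0 ≤ τ) : ‖X τ‖ ≤ 11 / 10 := by
  by_contra! hc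
  have h1 := h.radialPrimitive_norm_le hτ
  obtain ⟨h2, h3⟩ := norm_launchPoint_bounds
  have h4 := radialPrimitive_sub_of_ge (r := ‖launchPoint‖) (s := ‖X τ‖)
    (by linarith [exp_neg_two_lt]) (by linarith)
  linarith

theorem norm_velocity_lt (h : IsLaunchedTrajectory X V τ) (hτ : 0 ≤ τ) : ‖V τ‖ < 2 := by
  have h1 := h.mechanicalEnergy_le le_rfl hτ le_rfl
  have h2 := _root_.radialPrimitive_norm_le threshold (X τ)
  have h3 := radialPrimitive_nonneg (norm_nonneg (X τ))
  have h4 := radialPrimitive_le_mul (norm_nonneg launchPoint)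
  have h5 := radialSlope_le_half (norm_nonneg launchPoint)
  obtain ⟨h6, h7⟩ := norm_launchPoint_bounds
  rw [h.mechanicalEnergy_zero, mechanicalEnergy] at h1
  nlinarith [norm_nonneg (V τ)]

end IsLaunchedTrajectory

theorem truncatedGradient_apply_zero (a : ℝ) (x : EuclideanSpace ℝ (Fin 2)) :
    truncatedGradient a 0 x 0 = radialSlope ‖x‖ / ‖x‖ * x 0 + max (x 0 - a) 0 := by
  simp [truncatedGradient]

theorem truncatedGradient_apply_one (a : ℝ) (x : EuclideanSpace ℝ (Fin 2)) :
    truncatedGradient a 0 x 1 = radialSlope ‖x‖ / ‖x‖ * x 1 := by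
  simp [truncatedGradient]

theorem radialSlope_div_mul_le (x : EuclideanSpace ℝ (Fin 2)) (i : Fin 2) :
    radialSlope ‖x‖ / ‖x‖ * x i ≤ 1 / 2 := by
  have h1 : x i ≤ ‖x‖ := (le_abs_self _).trans (PiLp.norm_apply_le x i)
  have h2 := radialSlope_le_half (norm_nonneg x)
  have h3 := radialSlope_nonneg (norm_nonneg x)
  rcases (norm_nonneg x).eq_or_lt with h | h
  · rw [← h]
    norm_num
  · rw [div_mul_eq_mul_div, div_le_iff₀ h]
    nlinarith

namespace IsLaunchedTrajectory

variable {X V : ℝ → EuclideanSpace ℝ (Fin 2)} {τ : ℝ}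

theorem position_zero_apply_zero (h : IsLaunchedTrajectory X V τ) : X 0 0 = 1 := by
  rw [h.position_zero]
  rfl

theorem position_zero_apply_one (h : IsLaunchedTrajectory X V τ) : X 0 1 = 1 / 5 := by
  rw [h.position_zero]
  rfl

theorem le_position_apply_one (h : IsLaunchedTrajectory X V τ) (hτ : 0 ≤ τ) :
    1 / 5 - τ ^ 2 / 16 ≤ X τ 1 := by
  have := damped_position_ge (g := 1 / 2) hτ (h.position_apply 1) (h.continuous_velocity_apply 1)
    (h.velocity_zero_apply 1) (h.velocity_apply 1) (fun s _ => by
      rw [truncatedGradient_apply_one]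
      exact radialSlope_div_mul_le _ _)
  rw [h.position_zero_apply_one] at this
  linarith

theorem le_position_apply_zero (h : IsLaunchedTrajectory X V τ) (hτ : 0 ≤ τ) :
    1 - τ ^ 2 / 8 ≤ X τ 0 := by
  have := damped_position_ge (g := 1) hτ (h.position_apply 0) (h.continuous_velocity_apply 0)
    (h.velocity_zero_apply 0) (h.velocity_apply 0) (fun s hs => by
      have h1 := radialSlope_div_mul_le (X s) 0
      have h2 := (h.mono hs.2.le).norm_position_le hs.1.le
      have h3 := (le_abs_self _).trans (PiLp.norm_apply_le (X s) 0)
      have h4 : max (X s 0 - threshold) 0 ≤ 1 / 2 := by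
        rw [threshold_eq]
        exact max_le (by linarith) (by norm_num)
      rw [truncatedGradient_apply_zero]
      linarith)
  rw [h.position_zero_apply_zero] at this
  linarith

theorem le_force (h : IsLaunchedTrajectory X V τ) (hτ : 0 ≤ τ) (hp : 1 / 2 ≤ X τ 0) :
    1 / 8 ≤ truncatedGradient threshold 0 (X τ) 0 := by
  have h1 := (le_abs_self _).trans (PiLp.norm_apply_le (X τ) 0)
  have h2 := h.norm_position_le hτ
  rw [truncatedGradient_apply_zero, radialSlope_of_ge (by linarith [exp_neg_two_lt])]
  have h3 : 1 / 8 ≤ 1 / 2 / ‖X τ‖ * X τ 0 := by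
    rw [div_mul_eq_mul_div, le_div_iff₀ (by linarith)]
    linarith
  linarith [le_max_right (X τ 0 - threshold) 0]

/-- The force bound `1/8` gives `V₀ ≤ -s/32`, whence `‖V‖² ≥ V₀² ≥ s (-V₀)/32`. The dissipation
`3‖V‖²/s` therefore dominates `-(3/32) V₀`, which integrates to a displacement. -/
theorem mechanicalEnergy_le_of_half_lt (h : IsLaunchedTrajectory X V τ) (hτ : 0 ≤ τ)
    (hp : ∀ s ∈ Ico 0 τ, 1 / 2 < X s 0) :
    mechanicalEnergy X V τ ≤ mechanicalEnergy X V 0 - 3 / 32 * (1 - X τ 0) := by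
  have hE := h.continuous_mechanicalEnergy
  have hX : Continuous fun s => X s 0 :=
    continuous_iff_continuousAt.2 fun s => (h.position_apply 0 s).continuousAt
  have h1 := le_of_hasDerivAt_nonpos (f := fun s => mechanicalEnergy X V s - 3 / 32 * X s 0)
    (f' := fun s => -(3 / s * ‖V s‖ ^ 2) - 3 / 32 * V s 0) hτ
    (hE.sub (hX.const_mul _)).continuousOn
    (fun s hs => (h.hasDerivAt_mechanicalEnergy hs).sub ((h.position_apply 0 s).const_mul _)) ?_
  · simp only [h.position_zero_apply_zero] at h1
    linarith
  · intro s hs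
    have hs0 : 0 < s := hs.1
    have hu : V s 0 ≤ -(1 / 8 * s / 4) :=
      damped_velocity_le hs0.le (h.continuous_velocity_apply 0) (h.velocity_zero_apply 0)
        ((h.mono hs.2.le).velocity_apply 0) (fun x hx =>
          (h.mono (hx.2.trans hs.2).le).le_force hx.1.le (hp x ⟨hx.1.le, hx.2.trans hs.2⟩).le)
    have h2 : (V s 0) ^ 2 ≤ ‖V s‖ ^ 2 := by
      rw [← sq_abs]
      exact pow_le_pow_left₀ (abs_nonneg _) (PiLp.norm_apply_le (V s) 0) 2
    have h3 : 3 / s * (s * (-V s 0) / 32) ≤ 3 / s * ‖V s‖ ^ 2 := by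
      refine mul_le_mul_of_nonneg_left ?_ (by positivity)
      nlinarith
    have h4 : 3 / s * (s * (-V s 0) / 32) = -(3 / 32 * V s 0) := by field_simp
    simp only
    linarith

/-- Descending to `1/2` costs at least `3/64` of energy. The initial energy exceeds `F(a)` by at
most `(51/50 - 24/25)/2 + 1/1250 = 0.0308 < 3/64`, so too little is left to return beyond `a`. -/
theorem half_lt_of_threshold_lt (h : IsLaunchedTrajectory X V τ)
    (hp : threshold < X τ 0) : ∀ s ∈ Icc 0 τ, 1 / 2 < X s 0 := by
  intro s hs
  by_contra! hc
  have hX : Continuous fun s => X s 0 :=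
    continuous_iff_continuousAt.2 fun s => (h.position_apply 0 s).continuousAt
  obtain ⟨T, hT, hTle, hTlt⟩ := exists_first_nonpos (φ := fun s => X s 0 - 1 / 2)
    (hX.sub continuous_const) hs.1 (sub_nonpos.2 hc)
  have hTτ : T ≤ τ := hT.2.trans hs.2
  have h1 := (h.mono hTτ).mechanicalEnergy_le_of_half_lt hT.1
    (fun x hx => sub_pos.1 (hTlt x hx))
  have h2 := h.mechanicalEnergy_le hT.1 hTτ le_rfl
  have h3 := _root_.radialPrimitive_norm_le threshold (X τ)
  have h4 : radialPrimitive threshold ≤ radialPrimitive ‖X τ‖ :=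
    monotoneOn_radialPrimitive threshold_pos.le (norm_nonneg _)
      (hp.le.trans ((le_abs_self _).trans (PiLp.norm_apply_le (X τ) 0)))
  obtain ⟨h5, h6⟩ := norm_launchPoint_bounds
  have h7 := radialPrimitive_sub_of_ge (r := threshold) (s := ‖launchPoint‖)
    (by linarith [exp_neg_two_lt, threshold_eq]) (by linarith [threshold_eq])
  have h8 : mechanicalEnergy X V τ =
    1 / 2 * ‖V τ‖ ^ 2 + almostRadialPotential 1 threshold (X τ) := rfl
  rw [h.mechanicalEnergy_zero] at h1
  rw [threshold_eq] at *
  linarith [sq_nonneg ‖V τ‖]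

/-- As `x₁` stayed above `1/2`, `24/25 < x₁ ≤ 1 - τ²/64` forces `τ² < 64/25`. Then `x₂ ≥ 1/5 - τ²/16
> 1/25`. -/
theorem position_apply_one_pos (h : IsLaunchedTrajectory X V τ) (hτ : 0 ≤ τ)
    (hp : threshold < X τ 0) : 0 < X τ 1 := by
  have h1 := h.half_lt_of_threshold_lt hp
  have h2 := damped_position_le (g := 1 / 8) hτ (h.position_apply 0)
    (h.continuous_velocity_apply 0) (h.velocity_zero_apply 0) (h.velocity_apply 0)
    (fun s hs => (h.mono hs.2.le).le_force hs.1.le (h1 s ⟨hs.1.le, hs.2.le⟩).le)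
  have h3 := h.le_position_apply_one hτ
  rw [h.position_zero_apply_zero] at h2
  rw [threshold_eq] at hp
  linarith

end IsLaunchedTrajectory

/-! ### Angular momentum and the lower bound on the radius. -/

/-- The angular momentum multiplied by `t³`, which compensates the damping. -/
noncomputable def scaledMomentum (X V : ℝ → EuclideanSpace ℝ (Fin 2)) (t : ℝ) : ℝ :=
  t ^ 3 * (X t 0 * V t 1 - X t 1 * V t 0)

/-- The lower barrier for the distance to the origin. -/
noncomputable def radiusBarrier (t : ℝ) : ℝ := 1 / 1250000 / (1 + |t|) ^ 3

theorem radiusBarrier_pos (t : ℝ) : 0 < radiusBarrier t := by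
  unfold radiusBarrier
  positivity

theorem continuous_radiusBarrier : Continuous radiusBarrier := by
  unfold radiusBarrier
  exact continuous_const.div (by fun_prop) fun t => by positivity

theorem antitoneOn_radiusBarrier : AntitoneOn radiusBarrier (Ici 0) := by
  intro s hs t ht hst
  unfold radiusBarrier
  rw [mem_Ici] at hs ht
  rw [abs_of_nonneg hs, abs_of_nonneg ht]
  gcongr

theorem radiusBarrier_le (t : ℝ) : radiusBarrier t ≤ 1 / 1250000 :=
  div_le_self (by norm_num) (one_le_pow₀ (by linarith [abs_nonneg t]))

namespace IsLaunchedTrajectory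

variable {X V : ℝ → EuclideanSpace ℝ (Fin 2)} {τ : ℝ}

theorem continuous_scaledMomentum (h : IsLaunchedTrajectory X V τ) :
    Continuous (scaledMomentum X V) := by
  have h1 := h.continuous_position
  have h2 := h.continuous_velocity
  unfold scaledMomentum
  fun_prop

theorem hasDerivAt_scaledMomentum (h : IsLaunchedTrajectory X V τ) {t : ℝ} (ht : t ∈ Ioo 0 τ) :
    HasDerivAt (scaledMomentum X V) (t ^ 3 * (X t 1 * max (X t 0 - threshold) 0)) t := by
  have ht0 : t ≠ 0 := ht.1.ne'
  refine ((hasDerivAt_pow 3 t).mul (((h.position_apply 0 t).mul (h.velocity_apply 1 t ht)).sub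
    ((h.position_apply 1 t).mul (h.velocity_apply 0 t ht)))).congr_deriv ?_
  simp only [Pi.mul_apply, Pi.sub_apply]
  rw [truncatedGradient_apply_zero, truncatedGradient_apply_one]
  push_cast
  field_simp
  ring

theorem scaledMomentum_le (h : IsLaunchedTrajectory X V τ) {s : ℝ} (hs : 0 ≤ s) (hst : s ≤ τ) :
    scaledMomentum X V s ≤ scaledMomentum X V τ := by
  have h1 := le_of_hasDerivAt_nonpos (f := fun t => -scaledMomentum X V t) hst
    h.continuous_scaledMomentum.neg.continuousOn
    (fun t ht => (h.hasDerivAt_scaledMomentum ⟨hs.trans_lt ht.1, ht.2⟩).neg) ?_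
  · simpa using h1
  · intro t ht
    have ht0 : 0 < t := hs.trans_lt ht.1
    refine neg_nonpos.2 (mul_nonneg (by positivity) ?_)
    rcases le_or_gt (X t 0) threshold with hp | hp
    · rw [max_eq_right (by linarith), mul_zero]
    · exact mul_nonneg ((h.mono ht.2.le).position_apply_one_pos ht0.le hp).le (le_max_right _ _)

theorem le_scaledMomentum_of_le (h : IsLaunchedTrajectory X V τ) (hτ : 0 ≤ τ) (hτ' : τ ≤ 1 / 5) :
    τ ^ 4 / 1000 ≤ scaledMomentum X V τ := by
  have hM := h.continuous_scaledMomentum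
  have h1 := le_of_hasDerivAt_nonpos (f := fun t => t ^ 4 / 1000 - scaledMomentum X V t)
    -- For `t ≤ 1/5`, `x₂ ≥ 79/400` and `x₁ - a ≥ 7/200`, so their product exceeds `1/250`.
    (f' := fun t => t ^ 3 * (1 / 250 - X t 1 * max (X t 0 - threshold) 0)) hτ (by fun_prop)
    (fun t ht => (((hasDerivAt_pow 4 t).div_const 1000).sub
      (h.hasDerivAt_scaledMomentum ht)).congr_deriv (by push_cast; ring)) ?_
  · simp only [scaledMomentum] at h1 ⊢
    linarith
  · intro t ht
    have h2 := (h.mono ht.2.le).le_position_apply_one ht.1.le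
    have h3 := (h.mono ht.2.le).le_position_apply_zero ht.1.le
    have h4 : t ^ 2 ≤ 1 / 25 := by nlinarith [ht.1, ht.2]
    refine mul_nonpos_of_nonneg_of_nonpos (pow_nonneg ht.1.le 3) ?_
    have h5 : 7 / 200 ≤ max (X t 0 - threshold) 0 :=
      le_max_of_le_left (by rw [threshold_eq]; linarith)
    nlinarith

theorem le_scaledMomentum (h : IsLaunchedTrajectory X V τ) (hτ : 1 / 5 ≤ τ) :
    1 / 625000 ≤ scaledMomentum X V τ := by
  have h1 := (h.mono hτ).le_scaledMomentum_of_le (by norm_num) le_rfl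
  have h2 := h.scaledMomentum_le (by norm_num) hτ
  norm_num at h1 h2 ⊢
  linarith

theorem le_norm_mul_norm (h : IsLaunchedTrajectory X V τ) (hτ : 1 / 5 ≤ τ) :
    1 / 625000 ≤ τ ^ 3 * (‖X τ‖ * ‖V τ‖) := by
  refine (h.le_scaledMomentum hτ).trans (mul_le_mul_of_nonneg_left ?_ (by positivity))
  refine le_of_sq_le_sq ?_ (by positivity)
  rw [mul_pow, EuclideanSpace.real_norm_sq_eq, EuclideanSpace.real_norm_sq_eq, Fin.sum_univ_two,
    Fin.sum_univ_two]
  -- Lagrange's identity: the angular momentum squared plus this square is `‖X‖² ‖V‖²`.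
  nlinarith [sq_nonneg (X τ 0 * V τ 0 + X τ 1 * V τ 1)]

theorem radiusBarrier_lt (h : IsLaunchedTrajectory X V τ) (hτ : 0 ≤ τ) :
    radiusBarrier τ < ‖X τ‖ := by
  rcases le_or_gt τ (1 / 5) with h1 | h1
  · have h2 := h.le_position_apply_zero hτ
    have h3 := (le_abs_self _).trans (PiLp.norm_apply_le (X τ) 0)
    have h4 := radiusBarrier_le τ
    nlinarith
  · have h2 := h.le_norm_mul_norm h1.le
    have h3 := h.norm_velocity_lt hτ
    have h4 : 0 < τ := by linarith
    have h5 : 1 / 1250000 ≤ τ ^ 3 * ‖X τ‖ := by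
      have : τ ^ 3 * (‖X τ‖ * ‖V τ‖) ≤ τ ^ 3 * (‖X τ‖ * 2) := by gcongr
      linarith
    have h6 : 0 < ‖X τ‖ := by
      by_contra! h7
      have : τ ^ 3 * ‖X τ‖ ≤ 0 := mul_nonpos_of_nonneg_of_nonpos (by positivity) h7
      linarith
    rw [radiusBarrier, abs_of_pos h4, div_lt_iff₀ (by positivity)]
    refine h5.trans_lt ?_
    rw [mul_comm]
    have : τ ^ 3 < (1 + τ) ^ 3 := pow_lt_pow_left₀ (by linarith) h4.le (by norm_num)
    exact mul_lt_mul_of_pos_left this h6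

end IsLaunchedTrajectory

end Trajectory

section Conclusion

/-! ### Untruncating the solution, decay and infinite length. -/

open Filter Topology

theorem exists_launchedTrajectory :
    ∃ X V : ℝ → EuclideanSpace ℝ (Fin 2), ∀ τ, IsLaunchedTrajectory X V τ := by
  have hcont := continuous_truncatedGradient threshold continuous_radiusBarrier radiusBarrier_pos
  have hlip := fun t => norm_truncatedGradient_sub_le threshold (radiusBarrier_pos t)
  -- The factor `2` leaves room for `‖G t X₀‖ ≤ ℓ t`, because `‖X₀‖` slightly exceeds `1`.
  have hℓ : Continuous fun t => 2 * (1 / radiusBarrier t + 1) := by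
    have h : Continuous fun t => 1 / radiusBarrier t :=
      continuous_const.div continuous_radiusBarrier fun t => (radiusBarrier_pos t).ne'
    exact continuous_const.mul (h.add continuous_const)
  have hmono : MonotoneOn (fun t => 2 * (1 / radiusBarrier t + 1)) (Ici 0) := by
    intro s hs t ht hst
    have := one_div_le_one_div_of_le (radiusBarrier_pos t) (antitoneOn_radiusBarrier hs ht hst)
    simp only
    linarith
  have hpos : ∀ t, 0 < 1 / radiusBarrier t + 1 := fun t => by
    have := radiusBarrier_pos t
    positivity
  obtain ⟨X, V, hV, hX, hX0, hV0, hode⟩ := exists_solution_of_lipschitz hcont hℓ hmono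
    (fun t _ => by linarith [hpos t])
    (fun t _ x y => (hlip t x y).trans (by nlinarith [hpos t, norm_nonneg (x - y)])) launchPoint
    (fun t _ => by
      have h1 := hlip t launchPoint 0
      have h2 : truncatedGradient threshold (radiusBarrier t) 0 = 0 := by
        simp [truncatedGradient, threshold_pos.le]
      rw [h2, sub_zero, sub_zero] at h1
      nlinarith [hpos t, norm_launchPoint_bounds.2])
  have hXc : Continuous X := continuous_iff_continuousAt.2 fun t => (hX t).continuousAt
  have key : ∀ T, (∀ t ∈ Ioo 0 T, radiusBarrier t < ‖X t‖) → IsLaunchedTrajectory X V T :=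
    fun T h => ⟨hX, hV, hX0, hV0, fun t ht => by
      rw [← truncatedGradient_eq (h t ht).le]
      exact hode t ht.1⟩
  -- Bootstrap: up to the first time the barrier is met, the truncated and true equations agree, so
  -- the strict bound applies at that very time, a contradiction.
  have hfar : ∀ t, 0 ≤ t → radiusBarrier t < ‖X t‖ := by
    intro t ht
    by_contra! hc
    obtain ⟨T, hT, hTle, hTlt⟩ := exists_first_nonpos (φ := fun s => ‖X s‖ - radiusBarrier s)
      (hXc.norm.sub continuous_radiusBarrier) ht (sub_nonpos.2 hc)
    have := (key T fun s hs => sub_pos.1 (hTlt s ⟨hs.1.le, hs.2⟩)).radiusBarrier_lt hT.1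
    linarith
  exact ⟨X, V, fun T => key T fun t ht => hfar t ht.1.le⟩

namespace IsLaunchedTrajectory

variable {X V : ℝ → EuclideanSpace ℝ (Fin 2)}

/-- The Lyapunov function is `t² f(X) + 2‖X + (t/2) V‖²`; its initial value `2‖X₀‖²` is below `3`.
-/
theorem sq_mul_potential_le {τ : ℝ} (h : IsLaunchedTrajectory X V τ) (hτ : 0 ≤ τ) :
    τ ^ 2 * almostRadialPotential 1 threshold (X τ) ≤ 3 := by
  have hXc := h.continuous_position
  have hVc := h.continuous_velocity
  have hf := (contDiff_almostRadialPotential threshold).continuous.comp hXc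
  have hd : ∀ t ∈ Ioo 0 τ, HasDerivAt
      (fun t => t ^ 2 * almostRadialPotential 1 threshold (X t) +
        2 * ‖X t + (t / 2) • V t‖ ^ 2)
      (2 * t * (almostRadialPotential 1 threshold (X t) -
        inner ℝ (truncatedGradient threshold 0 (X t)) (X t))) t := by
    intro t ht
    have ht0 : t ≠ 0 := ht.1.ne'
    have h1 := (hasGradientAt_almostRadialPotential threshold (X t)).hasFDerivAt.comp_hasDerivAt t
      (h.position t)
    have h2 : HasDerivAt (fun t => X t + (t / 2) • V t)
        (-((t / 2) • truncatedGradient threshold 0 (X t))) t := by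
      refine ((h.position t).add (((hasDerivAt_id t).div_const 2).smul
        (h.velocity t ht))).congr_deriv ?_
      simp only [id, smul_sub, smul_neg, smul_smul]
      rw [show t / 2 * (3 / t) = 3 / 2 by field_simp]
      module
    refine (((hasDerivAt_pow 2 t).mul h1).add (h2.norm_sq.const_mul 2)).congr_deriv ?_
    rw [InnerProductSpace.toDual_apply_apply]
    simp only [Function.comp_apply, inner_neg_right, inner_add_left, inner_smul_left,
      inner_smul_right, RCLike.conj_to_real]
    rw [real_inner_comm (X t), real_inner_comm (V t)]
    push_cast
    ring
  have h1 := le_of_hasDerivAt_nonpos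
    (f := fun t => t ^ 2 * almostRadialPotential 1 threshold (X t) +
      2 * ‖X t + (t / 2) • V t‖ ^ 2) hτ
    (Continuous.continuousOn (((continuous_pow 2).mul hf).add (by fun_prop))) hd ?_
  · rw [h.position_zero] at h1
    simp only [ne_eq, OfNat.ofNat_ne_zero, not_false_eq_true, zero_pow, zero_mul, zero_div,
      zero_smul, add_zero, zero_add] at h1
    have h2 := norm_launchPoint_bounds
    have h3 : ‖launchPoint‖ ^ 2 ≤ 3 / 2 := by nlinarith [h2.1, h2.2]
    have h4 := sq_nonneg ‖X τ + (τ / 2) • V τ‖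
    linarith
  · intro t ht
    have h2 := almostRadialPotential_le_inner threshold_pos (X t)
    exact mul_nonpos_of_nonneg_of_nonpos (by linarith [ht.1]) (by linarith)

theorem log_bound_nonneg {t : ℝ} (ht : 0 ≤ t) :
    0 < Real.log 2500000 + 3 * Real.log (1 + t) := by
  have h1 : 0 < Real.log 2500000 := Real.log_pos (by norm_num)
  have h2 : 0 ≤ Real.log (1 + t) := Real.log_nonneg (by linarith)
  linarith

theorem radialSlope_half_radiusBarrier {t : ℝ} (ht : 0 ≤ t) :
    radialSlope (radiusBarrier t / 2) = 1 / (Real.log 2500000 + 3 * Real.log (1 + t)) := by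
  have hρ := radiusBarrier_pos t
  have h1 : radiusBarrier t / 2 ≤ Real.exp (-2) := by
    have h2 : Real.exp 2 ≤ 9 := by
      have h3 := Real.exp_one_lt_d9
      rw [show (2 : ℝ) = 1 + 1 by norm_num, Real.exp_add]
      nlinarith [Real.exp_pos 1]
    have h3 : 1 / 9 ≤ Real.exp (-2) := by
      rw [Real.exp_neg, inv_eq_one_div]
      exact one_div_le_one_div_of_le (Real.exp_pos _) h2
    linarith [radiusBarrier_le t]
  rw [radialSlope_of_le (by positivity) h1, ← Real.log_inv]
  have h2 : (radiusBarrier t / 2)⁻¹ = 2500000 * (1 + t) ^ 3 := by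
    rw [radiusBarrier, abs_of_nonneg ht]
    field_simp
    norm_num
  rw [h2, Real.log_mul (by norm_num) (by positivity), Real.log_pow]
  norm_num

/-- The lower barrier enters the upper bound: it keeps `F'(‖X‖/2)` above `1/L`, turning decay of
`F(‖X‖)` into decay of `‖X‖`. -/
theorem norm_position_le_log {τ : ℝ} (h : IsLaunchedTrajectory X V τ) (hτ : 0 ≤ τ) :
    τ ^ 2 * ‖X τ‖ ≤ 6 * (Real.log 2500000 + 3 * Real.log (1 + τ)) := by
  have h1 := h.sq_mul_potential_le hτ
  have h2 := _root_.radialPrimitive_norm_le threshold (X τ)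
  have h3 := half_mul_radialSlope_le (norm_nonneg (X τ))
  have h4 : radialSlope (radiusBarrier τ / 2) ≤ radialSlope (‖X τ‖ / 2) := by
    have h5 := h.radiusBarrier_lt hτ
    have h6 := radiusBarrier_pos τ
    exact monotoneOn_radialSlope (mem_Ici.2 (by linarith)) (mem_Ici.2 (by linarith)) (by linarith)
  rw [radialSlope_half_radiusBarrier hτ] at h4
  have hL := log_bound_nonneg hτ
  set L := Real.log 2500000 + 3 * Real.log (1 + τ)
  have h5 : ‖X τ‖ / 2 * (1 / L) ≤ almostRadialPotential 1 threshold (X τ) :=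
    (mul_le_mul_of_nonneg_left h4 (by positivity)).trans (h3.trans h2)
  have h6 : τ ^ 2 * (‖X τ‖ / 2 * (1 / L)) ≤ 3 :=
    (mul_le_mul_of_nonneg_left h5 (by positivity)).trans h1
  have h7 : τ ^ 2 * (‖X τ‖ / 2 * (1 / L)) = τ ^ 2 * ‖X τ‖ / (2 * L) := by field_simp
  rw [h7, div_le_iff₀ (by positivity)] at h6
  linarith

theorem not_integrableOn_velocity (h : ∀ τ, IsLaunchedTrajectory X V τ) :
    ¬ IntegrableOn V (Ioi 0) := by
  have hd : ∀ t : ℝ, 0 < t →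
      HasDerivAt (fun t => Real.log (Real.log 2500000 + 3 * Real.log (1 + t)))
        (3 * (1 / (1 + t)) / (Real.log 2500000 + 3 * Real.log (1 + t))) t := fun t ht =>
    (((((hasDerivAt_id t).const_add 1).log (by simp only [id]; linarith)).const_mul 3).const_add
      _).log (log_bound_nonneg ht.le).ne'
  -- The unbounded comparison function is `log L(t)`, of order `log log t`, whose derivative `3 /
  -- ((1 + t) L)` is `O(‖V‖)`.
  refine not_integrableOn_of_tendsto_norm_atTop_of_deriv_isBigO_filter atTop (Ioi_mem_atTop 0)
    (f := fun t => Real.log (Real.log 2500000 + 3 * Real.log (1 + t))) ?_ ?_ ?_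
  · filter_upwards [eventually_gt_atTop 0] with t ht using (hd t ht).differentiableAt
  · refine tendsto_norm_atTop_atTop.comp (Real.tendsto_log_atTop.comp ?_)
    refine tendsto_atTop_add_const_left _ _ (Tendsto.const_mul_atTop (by norm_num) ?_)
    exact Real.tendsto_log_atTop.comp (tendsto_atTop_add_const_left _ _ tendsto_id)
  · refine Asymptotics.IsBigO.of_bound (18 * 625000) ?_
    filter_upwards [eventually_ge_atTop 1] with t ht
    have ht0 : 0 < t := by linarith
    have hL := log_bound_nonneg ht0.le
    rw [(hd t ht0).deriv, Real.norm_of_nonneg (by positivity)]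
    have h1 := (h t).le_norm_mul_norm (by linarith)
    have h2 := (h t).norm_position_le_log ht0.le
    set L := Real.log 2500000 + 3 * Real.log (1 + t)
    have h3 : 1 / 625000 ≤ t * ‖V t‖ * (6 * L) := by
      calc 1 / 625000 ≤ t ^ 3 * (‖X t‖ * ‖V t‖) := h1
        _ = t * ‖V t‖ * (t ^ 2 * ‖X t‖) := by ring
        _ ≤ t * ‖V t‖ * (6 * L) := by gcongr
    rw [div_le_iff₀ hL, mul_one_div, div_le_iff₀ (by linarith)]
    nlinarith [mul_nonneg (norm_nonneg (V t)) hL.le]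

theorem isGlobalNesterovSolution (h : ∀ τ, IsLaunchedTrajectory X V τ) :
    IsGlobalNesterovSolution (almostRadialPotential 1 threshold) launchPoint X := by
  have hdX : deriv X = V := funext fun t => ((h 0).position t).deriv
  have hdV : ∀ t, 0 < t →
      HasDerivAt V (-((3 / t) • V t) - truncatedGradient threshold 0 (X t)) t := fun t ht =>
    (h (t + 1)).velocity t ⟨ht, by linarith⟩
  have hXdiff : Differentiable ℝ X := fun t => ((h 0).position t).differentiableAt
  have hVc := (h 0).continuous_velocity
  have hXc := (h 0).continuous_position
  refine ⟨?_, ?_, fun t ht => ?_, (h 0).position_zero, ?_⟩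
  · refine (contDiff_one_iff_deriv.2 ⟨hXdiff, ?_⟩).contDiffOn
    rwa [hdX]
  · have h2 : ContDiffOn ℝ (1 + 1) X (Ioi 0) := by
      rw [contDiffOn_succ_iff_deriv_of_isOpen isOpen_Ioi]
      refine ⟨hXdiff.differentiableOn, by simp, ?_⟩
      have h1 : ContDiffOn ℝ (0 + 1) (deriv X) (Ioi 0) := by
        rw [hdX, contDiffOn_succ_iff_deriv_of_isOpen isOpen_Ioi]
        refine ⟨fun t ht => (hdV t ht).differentiableAt.differentiableWithinAt, by simp, ?_⟩
        rw [contDiffOn_zero]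
        have hc : ContinuousOn
            (fun t => -((3 / t) • V t) - truncatedGradient threshold 0 (X t)) (Ioi 0) := by
          have h3 : ContinuousOn (fun t : ℝ => 3 / t) (Ioi 0) :=
            continuousOn_const.div continuousOn_id fun t ht => (mem_Ioi.1 ht).ne'
          exact (h3.smul hVc.continuousOn).neg.sub
            ((continuous_gradientField threshold).comp hXc).continuousOn
        exact hc.congr fun t ht => (hdV t ht).deriv
      simpa using h1
    exact h2.of_le (by norm_num)
  · rw [hdX, (hdV t ht).deriv, (hasGradientAt_almostRadialPotential threshold (X t)).gradient]
    abel
  · have := (h 0).position 0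
    rw [(h 0).velocity_zero] at this
    exact this.hasDerivWithinAt

theorem pathLength_eq_top (h : ∀ τ, IsLaunchedTrajectory X V τ) : pathLength X = ⊤ := by
  have hdX : deriv X = V := funext fun t => ((h 0).position t).deriv
  by_contra hc
  refine not_integrableOn_velocity h
    ⟨(h 0).continuous_velocity.aestronglyMeasurable, lt_top_iff_ne_top.2 ?_⟩
  rwa [pathLength, hdX] at hc

end IsLaunchedTrajectory

end Conclusion

theorem mainTheorem1 :
    ∃ f : EuclideanSpace ℝ (Fin 2) → ℝ,
      (∃ a ε : ℝ, 0 < a ∧ 0 < ε ∧ f = almostRadialPotential ε a) ∧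
      ConvexOn ℝ Set.univ f ∧
      ContDiff ℝ 1 f ∧
      (∀ x : EuclideanSpace ℝ (Fin 2), IsMinOn f Set.univ x ↔ x = 0) ∧
      ∃ (X₀ : EuclideanSpace ℝ (Fin 2)) (X : ℝ → EuclideanSpace ℝ (Fin 2)),
        X₀ ≠ 0 ∧ IsGlobalNesterovSolution f X₀ X ∧ pathLength X = ⊤ := by
  obtain ⟨X, V, h⟩ := exists_launchedTrajectory
  refine ⟨almostRadialPotential 1 threshold, ⟨threshold, 1, threshold_pos, one_pos, rfl⟩,
    convexOn_almostRadialPotential _, contDiff_almostRadialPotential _,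
    isMinOn_almostRadialPotential_iff threshold_pos, launchPoint, X, ?_,
    IsLaunchedTrajectory.isGlobalNesterovSolution h, IsLaunchedTrajectory.pathLength_eq_top h⟩
  rw [← norm_pos_iff]
  linarith [norm_launchPoint_bounds.1]
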